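/- Let $\zeta=e^{2\pi i/6}$, $\Gamma_\zeta=\mathbb Z\zeta\oplus\mathbb Z$, $E'=\mathbb C/\Gamma_\zeta$, $V=\mathbb C^2$ with standard basis $e_1,e_2$, $\lambda_1=\zeta e_1$, $\lambda_2=\zeta e_2$, $\Lambda_{A'}=\Gamma_\zeta\times\Gamma_\zeta=\mathbb Z\lambda_1\oplus\mathbb Z\lambda_2\oplus\mathbb Z e_1\oplus\mathbb Z e_2$ and $A'=E'\times E'=V/\Lambda_{A'}$. Let $E_1',E_2',E_3',E_4'\subset A'$ be the elliptic curves that are the images of the lines spanned by $e_1$, $e_2$, $e_1+e_2$, $e_1+\zeta e_2$, respectively, and let $D_{A'}=E_1'+E_2'+E_3'+E_4'$. Writing a character $\chi\colon\Lambda_{A'}\to\{\pm1\}$ as $(\chi(\lambda_1),\chi(\lambda_2),\chi(e_1),\chi(e_2))$, put $$\chi_1=(-1,-1,1,-1),\qquad \chi_2=(1,-1,-1,1),\qquad \chi_3=(-1,1,-1,-1).$$ For $i\in\{1,2,3\}$ let $A_i=V/\ker\chi_i$, let $f_i\colon A_i\to A'$ be the isogeny of degree $2$ induced by the identity of $V$,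 and let $D_{A_i}=f_i^*D_{A'}$. Then $\chi_1,\chi_2,\chi_3$ are exactly the non-trivial elements of the group $\varSigma$ generated by $\chi_1$ and $\chi_2$, the complex tori $A_1,A_2,A_3$ are abelian surfaces, and they are pairwise isomorphic. More precisely: (1) The $\mathbb C$-linear map $V\to V$ with $e_1\mapsto-\zeta e_1$, $e_2\mapsto e_1+e_2$ induces an automorphism $\gamma$ of the abelian surface $A'$ (a biholomorphic group automorphism), which has order $3$ and satisfies $\gamma^*D_{A'}=D_{A'}$. (2) Put $\gamma_{11}=\gamma_{22}=\gamma_{33}=\mathrm{id}$, $\gamma_{13}=\gamma_{21}=\gamma_{32}=\gamma$ and $\gamma_{31}=\gamma_{12}=\gamma_{23}=\gamma^2$. For all $i,j\in\{1,2,3\}$ there is an isomorphism of abelian surfaces (a biholomorphic group isomorphism) $\tilde\gamma_{ij}\colon A_j\to A_i$ such that $f_i\circ\tilde\gamma_{ij}=\gamma_{ij}\circ f_j$ and $\tilde\gamma_{ij}^*D_{A_i}=D_{A_j}$. -/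

import Mathlib

open scoped Manifold ContDiff Topology

noncomputable section

namespace Equianharmonic

/-! ### Complex tori `V / L` as complex manifolds -/

/-- The vector space `V = ℂ²`. -/
abbrev V : Type := ℂ × ℂ

/-- The quotient `V / L`, for an additive subgroup `L` of `V`. -/
abbrev Torus (L : AddSubgroup V) : Type := V ⧸ L

theorem isLocalHomeomorph_mk (L : AddSubgroup V) [DiscreteTopology L] :
    IsLocalHomeomorph (QuotientAddGroup.mk : V → Torus L) :=
  (AddSubgroup.isAddQuotientCoveringMap_of_comm L
    (isDiscrete_iff_discreteTopology.mpr inferInstance)).isCoveringMap.isLocalHomeomorph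

/-- The quotient complex structure on `V / L` for a discrete subgroup `L`: the charts are the local
inverses of the projection `V → V / L`. -/
instance instChartedSpaceTorus (L : AddSubgroup V) [DiscreteTopology L] :
    ChartedSpace V (Torus L) :=
  (isLocalHomeomorph_mk L).chartedSpace Quotient.mk_surjective

/-- Two continuous lifts of the same map to `V / L` differ locally by a constant. -/
theorem eventually_sub_eq (L : AddSubgroup V) [DiscreteTopology L] {g : V → V} {u : V}
    (hg : ContinuousAt g u)
    (h : ∀ᶠ y in 𝓝 u, (QuotientAddGroup.mk (g y) : Torus L) = QuotientAddGroup.mk y) :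
    ∀ᶠ y in 𝓝 u, g y = y + (g u - u) := by
  obtain ⟨U, hU, hUL⟩ := (discreteTopology_subtype_iff'.mp
    (inferInstanceAs (DiscreteTopology (L : Set V)))) 0 L.zero_mem
  have hmem : ∀ᶠ y in 𝓝 u, g y - y ∈ L := h.mono fun y hy => by
    have := (QuotientAddGroup.eq.mp hy.symm)
    rwa [neg_add_eq_sub] at this
  have hu : g u - u ∈ L := hmem.self_of_nhds
  have hc : ContinuousAt (fun y => (g y - y) - (g u - u)) u :=
    (hg.sub continuousAt_id).sub continuousAt_const
  have h0 : ∀ᶠ y in 𝓝 u, (g y - y) - (g u - u) ∈ U := by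
    apply hc.eventually_mem
    have : (0 : V) ∈ U := (hUL.ge rfl).1
    simpa using hU.mem_nhds this
  filter_upwards [hmem, h0] with y h1 h2
  have h3 : (g y - y) - (g u - u) ∈ U ∩ (L : Set V) := ⟨h2, L.sub_mem h1 hu⟩
  rw [hUL, Set.mem_singleton_iff, sub_eq_zero] at h3
  rw [← h3]; abel

instance instIsManifoldTorus (L : AddSubgroup V) [DiscreteTopology L] :
    IsManifold 𝓘(ℂ, V) ω (Torus L) := by
  refine isManifold_of_contDiffOn _ _ _ ?_
  rintro _ _ ⟨x, rfl⟩ ⟨x', rfl⟩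
  set e := (isLocalHomeomorph_mk L).localInverseAt
    (Quotient.mk_surjective.hasRightInverse.choose x)
  set e' := (isLocalHomeomorph_mk L).localInverseAt
    (Quotient.mk_surjective.hasRightInverse.choose x') with he'
  have hes : ∀ u, e.symm u = (QuotientAddGroup.mk u : Torus L) := fun u => by simp [e]
  have key : ContDiffOn ℂ ω (e.symm ≫ₕ e') (e.symm ≫ₕ e').source := by
    intro u hu
    apply ContDiffAt.contDiffWithinAt
    have hev := eventually_sub_eq L (g := e.symm ≫ₕ e') (u := u)
      ((e.symm ≫ₕ e').continuousAt hu) (by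
        filter_upwards [(e.symm ≫ₕ e').open_source.mem_nhds hu] with y hy
        rw [OpenPartialHomeomorph.trans_source] at hy
        have hy2 : e.symm y ∈ e'.source := hy.2
        rw [← hes y]
        exact (isLocalHomeomorph_mk L).apply_localInverseAt_of_mem hy2)
    exact (contDiffAt_id.add contDiffAt_const).congr_of_eventuallyEq hev
  refine key.mono ?_
  rintro u ⟨⟨⟨-, h1⟩, h2⟩, -⟩
  exact ⟨h1, h2.1⟩

/-! ### Effective divisors on complex surfaces, through their ideal sheaves -/

section Divisors

variable {X Y : Type} [TopologicalSpace X] [ChartedSpace V X] [TopologicalSpace Y]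
  [ChartedSpace V Y]

/-- `f` is holomorphic near `x`. -/
abbrev HolomorphicNear (f : X → ℂ) (x : X) : Prop :=
  ContMDiffAt 𝓘(ℂ, V) 𝓘(ℂ, ℂ) ω f x

/-- The local ring `𝒪_{X,x}` of germs at `x` of holomorphic functions. -/
def holGerm (x : X) : Subring (Filter.Germ (𝓝 x) ℂ) where
  carrier := {φ | ∃ f : X → ℂ, HolomorphicNear f x ∧ (f : Filter.Germ (𝓝 x) ℂ) = φ}
  mul_mem' := by
    rintro _ _ ⟨f, hf, rfl⟩ ⟨g, hg, rfl⟩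
    exact ⟨f * g, hf.mul hg, rfl⟩
  one_mem' := ⟨1, contMDiffAt_const, rfl⟩
  add_mem' := by
    rintro _ _ ⟨f, hf, rfl⟩ ⟨g, hg, rfl⟩
    exact ⟨f + g, hf.add hg, rfl⟩
  zero_mem' := ⟨0, contMDiffAt_const, rfl⟩
  neg_mem' := by
    rintro _ ⟨f, hf, rfl⟩
    exact ⟨-f, hf.neg, rfl⟩

variable (X) in
/-- An effective divisor `D` is recorded by the stalks of its ideal sheaf `𝒪_X(-D) ⊆ 𝒪_X`.
Ideals multiply pointwise, and the sum of effective divisors is the product of their ideals. -/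
abbrev IdealStalks : Type := ∀ x : X, Ideal (holGerm x)

/-- The ideal of a reduced curve `C ⊆ X`: at `x`, the germs of holomorphic functions that vanish
on `C` near `x`. -/
def reducedCurve (C : Set X) : IdealStalks X := fun x =>
  { carrier := {φ | ∃ f : X → ℂ, (f : Filter.Germ (𝓝 x) ℂ) = φ ∧ ∀ᶠ y in 𝓝 x, y ∈ C → f y = 0}
    add_mem' := by
      rintro ⟨_, _⟩ ⟨_, _⟩ ⟨f, rfl, hf⟩ ⟨g, rfl, hg⟩
      refine ⟨f + g, rfl, ?_⟩
      filter_upwards [hf, hg] with y h1 h2 hy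
      simp [h1 hy, h2 hy]
    zero_mem' := ⟨0, rfl, by simp⟩
    smul_mem' := by
      rintro ⟨_, g, -, rfl⟩ ⟨_, _⟩ ⟨f, rfl, hf⟩
      refine ⟨g * f, rfl, ?_⟩
      filter_upwards [hf] with y h hy
      simp [h hy] }

/-- The pull-back `f^* D` under a holomorphic map `f`: its ideal at `x` is generated by the
germs `g ∘ f`, where the germ of `g` at `f x` is in the ideal of `D`. -/
def pullback (f : X → Y) (D : IdealStalks Y) : IdealStalks X := fun x =>
  Ideal.span {φ : holGerm x | ∃ (g : Y → ℂ) (hg : HolomorphicNear g (f x)),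
    (⟨(g : Filter.Germ (𝓝 (f x)) ℂ), g, hg, rfl⟩ : holGerm (f x)) ∈ D (f x) ∧
      ((g ∘ f : X → ℂ) : Filter.Germ (𝓝 x) ℂ) = φ}

end Divisors

/-! ### The equianharmonic product -/

/-- `ζ = e^{2πi/6}`. -/
def ζ : ℂ := Complex.exp (2 * Real.pi * Complex.I / 6)

/-- The lattice `Γ_ζ = ℤ ζ ⊕ ℤ` in `ℂ`. -/
def Γζ : AddSubgroup ℂ := AddSubgroup.closure {ζ, 1}

/-- The lattice `Λ_{A'} = Γ_ζ × Γ_ζ` in `V`. -/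
def lattice : AddSubgroup V := Γζ.prod Γζ

/-- The vectors `λ₁ = ζ e₁`, `λ₂ = ζ e₂`, `e₁`, `e₂`, in this order. -/
def latticeVec : Fin 4 → V := ![(ζ, 0), (0, ζ), (1, 0), (0, 1)]

theorem zeta_eq : ζ = ⟨1 / 2, √3 / 2⟩ := by
  have h : (2 * Real.pi * Complex.I / 6 : ℂ) = ((Real.pi / 3 : ℝ) : ℂ) * Complex.I := by
    push_cast; ring
  rw [ζ, h, Complex.exp_mul_I, ← Complex.ofReal_cos, ← Complex.ofReal_sin, Real.cos_pi_div_three,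
    Real.sin_pi_div_three]
  apply Complex.ext <;> simp

theorem mem_Γζ {z : ℂ} : z ∈ Γζ ↔ ∃ m n : ℤ, m • ζ + n • (1 : ℂ) = z :=
  AddSubgroup.mem_closure_pair

theorem linearIndependent_latticeVec : LinearIndependent ℝ latticeVec := by
  rw [Fintype.linearIndependent_iff]
  intro g hg
  have h3 : √3 ≠ 0 := by positivity
  simp only [latticeVec, Fin.sum_univ_four, zeta_eq] at hg
  obtain ⟨h1, h2⟩ := Prod.ext_iff.mp hg
  have a1 := congrArg Complex.re h1
  have a2 := congrArg Complex.im h1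
  have b1 := congrArg Complex.re h2
  have b2 := congrArg Complex.im h2
  simp [h3] at a1 a2 b1 b2
  intro i
  fin_cases i <;> simp_all

theorem latticeVec_mem (i : Fin 4) : latticeVec i ∈ lattice := by
  have h1 : ζ ∈ Γζ := AddSubgroup.subset_closure (by simp)
  have h2 : (1 : ℂ) ∈ Γζ := AddSubgroup.subset_closure (by simp)
  have h0 : (0 : ℂ) ∈ Γζ := Γζ.zero_mem
  fin_cases i <;> simp [latticeVec, lattice, AddSubgroup.mem_prod, h0, h1, h2]

/-- `λ₁, λ₂, e₁, e₂` as a `ℤ`-basis of `Λ_{A'}`. -/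
def latticeBasis : Module.Basis (Fin 4) ℤ lattice :=
  Module.Basis.mk (v := fun i => (⟨latticeVec i, latticeVec_mem i⟩ : lattice))
    (LinearIndependent.of_comp lattice.subtype.toIntLinearMap
      (linearIndependent_latticeVec.restrict_scalars' ℤ))
    (by
      rintro ⟨⟨z, w⟩, hz, hw⟩ -
      obtain ⟨m, n, rfl⟩ := mem_Γζ.mp hz
      obtain ⟨p, q, rfl⟩ := mem_Γζ.mp hw
      rw [Submodule.mem_span_range_iff_exists_fun]
      refine ⟨![m, p, n, q], Subtype.ext ?_⟩
      simp [Fin.sum_univ_four, latticeVec])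

theorem latticeBasis_apply (i : Fin 4) : (latticeBasis i : V) = latticeVec i := by
  simp [latticeBasis]

instance instDiscreteLattice : DiscreteTopology lattice := by
  let b : Module.Basis (Fin 4) ℝ V := basisOfLinearIndependentOfCardEqFinrank
    linearIndependent_latticeVec (by simp)
  have hb : ⇑b = latticeVec := by simp [b]
  have hsub : (lattice : Set V) ⊆ (Submodule.span ℤ (Set.range b) : Set V) := by
    intro x hx
    have := latticeBasis.sum_repr ⟨x, hx⟩
    have h2 := congrArg (lattice.subtype) this
    simp only [map_sum, map_zsmul, AddSubgroup.subtype_apply, latticeBasis_apply] at h2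
    rw [← h2, hb]
    exact Submodule.sum_mem _ fun i _ =>
      Submodule.smul_mem _ _ (Submodule.subset_span ⟨i, rfl⟩)
  exact DiscreteTopology.of_subset (s := (Submodule.span ℤ (Set.range b) : Set V))
    (inferInstanceAs (DiscreteTopology (Submodule.span ℤ (Set.range b)))) hsub

/-- The equianharmonic product `A' = E' × E' = V / Λ_{A'}`, where `E' = ℂ / Γ_ζ`. -/
abbrev A' : Type := Torus lattice

/-- The complex lines `V₁ = span(e₁)`, `V₂ = span(e₂)`, `V₃ = span(e₁ + e₂)`,
`V₄ = span(e₁ + ζ e₂)`. -/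
def line : Fin 4 → Submodule ℂ V :=
  ![ℂ ∙ ((1, 0) : V), ℂ ∙ ((0, 1) : V), ℂ ∙ ((1, 1) : V), ℂ ∙ ((1, ζ) : V)]

/-- The elliptic curve `E'_k ⊆ A'`, the image of `V_k`. -/
def E' (k : Fin 4) : Set A' := QuotientAddGroup.mk '' (line k : Set V)

/-- The divisor `D_{A'} = E'₁ + E'₂ + E'₃ + E'₄`. -/
def divA' : IdealStalks A' := ∏ k : Fin 4, reducedCurve (E' k)

/-! ### The étale double covers of the equianharmonic product -/

/-- The group of characters `χ : Λ_{A'} → {±1}`, written additively (the trivial one is `0`). -/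
abbrev SignChar : Type := lattice →+ Additive ℤˣ

/-- The character with prescribed values at `λ₁, λ₂, e₁, e₂`. -/
def ofValues (ε : Fin 4 → ℤˣ) : SignChar :=
  (latticeBasis.constr ℤ fun i => Additive.ofMul (ε i)).toAddMonoidHom

/-- `ker χ`, as a subgroup of `V`. -/
def kerLattice (χ : SignChar) : AddSubgroup V := χ.ker.map lattice.subtype

theorem kerLattice_le (χ : SignChar) : kerLattice χ ≤ lattice := by
  rintro _ ⟨x, -, rfl⟩
  exact x.2

instance instDiscreteKerLattice (χ : SignChar) : DiscreteTopology (kerLattice χ) :=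
  DiscreteTopology.of_subset (s := (lattice : Set V)) instDiscreteLattice (kerLattice_le χ)

/-- The surface `A_χ = V / ker χ`. -/
abbrev cover (χ : SignChar) : Type := Torus (kerLattice χ)

/-- The isogeny `f_χ : A_χ → A'`, induced by the identity of `V`. -/
def isogeny (χ : SignChar) : cover χ →+ A' :=
  QuotientAddGroup.map _ _ (AddMonoidHom.id V) (kerLattice_le χ)

/-- The divisor `D_{A_χ} = f_χ^* D_{A'}`. -/
def divCover (χ : SignChar) : IdealStalks (cover χ) := pullback (isogeny χ) divA'

/-- The characters `χ₁`, `χ₂`, `χ₃` (with indices `0`, `1`, `2`). -/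
def chi : Fin 3 → SignChar :=
  ![ofValues ![-1, -1, 1, -1], ofValues ![1, -1, -1, 1], ofValues ![-1, 1, -1, -1]]

/-- The group `Σ` generated by `χ₁` and `χ₂`. -/
def Sig : AddSubgroup SignChar := AddSubgroup.closure {chi 0, chi 1}

/-- The subgroup `L ⊆ V` is a lattice and `V / L` is an abelian surface, i.e. it carries a
polarization: a positive definite hermitian form whose imaginary part is integral on `L`. -/
structure IsAbelianSurface (L : AddSubgroup V) : Prop where
  discrete : DiscreteTopology L
  span_eq_top : Submodule.span ℝ (L : Set V) = ⊤
  polarization : ∃ h : V →ₗ[ℂ] V →ₗ⋆[ℂ] ℂ,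
    (∀ v w, h w v = starRingEnd ℂ (h v w)) ∧ (∀ v, v ≠ 0 → 0 < (h v v).re) ∧
      ∀ v ∈ L, ∀ w ∈ L, ∃ n : ℤ, (h v w).im = n

/-- The linear automorphism of `V` with `e₁ ↦ -ζ e₁` and `e₂ ↦ e₁ + e₂`. -/
def gammaLin (v : V) : V := (-ζ * v.1 + v.2, v.2)

end Equianharmonic

end

open scoped Manifold ContDiff Topology

noncomputable section

namespace Equianharmonic

/-! ### Holomorphic maps between complex tori -/

section TorusMaps

variable (L M : AddSubgroup V) [DiscreteTopology L] [DiscreteTopology M]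

/-! Everything is linear algebra on `V`. The map `gammaLin` is multiplication by the primitive cube
root of unity `-ζ` on the line of `e₁` and the identity modulo that line, so it has order 3. It
preserves the lattice, fixes the first line and permutes the other three cyclically (`map_line_le`),
so the induced `gamma` preserves the divisor of `A'`.

The key point is `chi_gammaLattice`: composition with `gammaLin` permutes the three characters
cyclically. Hence its power with exponent `i - j` modulo 3 carries `ker χ_j` onto `ker χ_i` and
descends to an isomorphism of the covers lying over the same power of `gamma`. Compatibility with
the divisors is then formal, by functoriality of `pullback`. -/

variable {L} in
theorem mk_chartAt {x y : Torus L} (hy : y ∈ (chartAt V x).source) :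
    (QuotientAddGroup.mk (chartAt V x y) : Torus L) = y :=
  (isLocalHomeomorph_mk L).apply_localInverseAt_of_mem
    (x := Quotient.mk_surjective.hasRightInverse.choose x) hy.1

theorem contMDiff_mk :
    ContMDiff 𝓘(ℂ, V) 𝓘(ℂ, V) ω (QuotientAddGroup.mk : V → Torus L) := by
  intro u
  have hcont : Continuous (QuotientAddGroup.mk : V → Torus L) :=
    (isLocalHomeomorph_mk L).continuous
  rw [contMDiffAt_iff]
  refine ⟨hcont.continuousAt, ?_⟩
  set e := chartAt V (QuotientAddGroup.mk u : Torus L) with he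
  -- A chart composed with the projection is another local lift of the projection, hence a
  -- translation near `u`.
  have hu : (QuotientAddGroup.mk u : Torus L) ∈ e.source := mem_chart_source V _
  have hev := eventually_sub_eq L (g := fun y => e (QuotientAddGroup.mk y)) (u := u)
    ((e.continuousAt hu).comp hcont.continuousAt) (by
      filter_upwards [hcont.continuousAt.eventually_mem (e.open_source.mem_nhds hu)] with y hy
      exact mk_chartAt hy)
  have : ContDiffAt ℂ ω (fun y => e (QuotientAddGroup.mk y : Torus L)) u :=
    (contDiffAt_id.add contDiffAt_const).congr_of_eventuallyEq hev
  rw [extChartAt_model_space_eq_id, modelWithCornersSelf_coe, Set.range_id]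
  exact this.contDiffWithinAt

variable {L} in
/-- Holomorphy of a map from a torus can be checked after composing with the projection. -/
theorem contMDiff_of_comp_mk {N : Type} [TopologicalSpace N] [ChartedSpace V N] {F : Torus L → N}
    (hF : ContMDiff 𝓘(ℂ, V) 𝓘(ℂ, V) ω (fun v : V => F (QuotientAddGroup.mk v))) :
    ContMDiff 𝓘(ℂ, V) 𝓘(ℂ, V) ω F := by
  intro x
  set e := chartAt V x with he
  have hx : x ∈ e.source := mem_chart_source V _
  have h1 : ContMDiffAt 𝓘(ℂ, V) 𝓘(ℂ, V) ω e x := contMDiffAt_of_mem_maximalAtlas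
    (IsManifold.chart_mem_maximalAtlas x) hx
  refine (ContMDiffAt.comp x (hF (e x)) h1).congr_of_eventuallyEq ?_
  filter_upwards [e.open_source.mem_nhds hx] with y hy
  exact congrArg F (mk_chartAt hy).symm

variable {L M}

/-- A linear automorphism of `V` that carries `L` onto `M` induces a biholomorphic group
isomorphism `V / L → V / M`. -/
def torusDiffeo (g : V ≃L[ℂ] V) (h : ∀ v, g v ∈ M ↔ v ∈ L) :
    Diffeomorph 𝓘(ℂ, V) 𝓘(ℂ, V) (Torus L) (Torus M) ω where
  toFun := QuotientAddGroup.map L M (g : V →+ V) fun v hv => (h v).2 hv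
  invFun := QuotientAddGroup.map M L (g.symm : V →+ V) fun v hv => by
    rw [← g.apply_symm_apply v] at hv
    exact (h _).1 hv
  left_inv := by
    rintro ⟨v⟩
    exact congrArg QuotientAddGroup.mk (g.symm_apply_apply v)
  right_inv := by
    rintro ⟨v⟩
    exact congrArg QuotientAddGroup.mk (g.apply_symm_apply v)
  contMDiff_toFun := contMDiff_of_comp_mk ((contMDiff_mk M).comp g.contDiff.contMDiff)
  contMDiff_invFun := contMDiff_of_comp_mk ((contMDiff_mk L).comp g.symm.contDiff.contMDiff)

theorem torusDiffeo_add (g : V ≃L[ℂ] V) (h : ∀ v, g v ∈ M ↔ v ∈ L) (x y : Torus L) :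
    torusDiffeo g h (x + y) = torusDiffeo g h x + torusDiffeo g h y :=
  map_add (QuotientAddGroup.map L M (g : V →+ V) fun v hv => (h v).2 hv) x y

end TorusMaps

/-! ### Pull-back of divisors -/

section Pullback

variable {X Y Z : Type} [TopologicalSpace X] [ChartedSpace V X] [TopologicalSpace Y]
  [ChartedSpace V Y] [TopologicalSpace Z] [ChartedSpace V Z]

/-- The homomorphism `𝒪_{Y,f(x)} → 𝒪_{X,x}` given by composition with a holomorphic map `f`. -/
def germComap (f : X → Y) (hf : ContMDiff 𝓘(ℂ, V) 𝓘(ℂ, V) ω f) (x : X) :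
    holGerm (f x) →+* holGerm x where
  toFun φ := ⟨φ.1.compTendsto f hf.continuous.continuousAt, by
    obtain ⟨_, g, hg, rfl⟩ := φ
    exact ⟨g ∘ f, hg.comp x (hf x), rfl⟩⟩
  map_one' := rfl
  map_zero' := rfl
  map_mul' := by
    rintro ⟨_, g, hg, rfl⟩ ⟨_, h, hh, rfl⟩
    rfl
  map_add' := by
    rintro ⟨_, g, hg, rfl⟩ ⟨_, h, hh, rfl⟩
    rfl

/-- As extension of ideals along a ring homomorphism, `pullback` inherits functoriality and
compatibility with products from `Ideal.map`. -/
theorem pullback_apply {f : X → Y} (hf : ContMDiff 𝓘(ℂ, V) 𝓘(ℂ, V) ω f) (D : IdealStalks Y)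
    (x : X) : pullback f D x = (D (f x)).map (germComap f hf x) := by
  rw [pullback, Ideal.map]
  refine congrArg Ideal.span (Set.ext fun φ => ?_)
  constructor
  · rintro ⟨g, hg, hD, h⟩
    exact ⟨_, hD, Subtype.ext h⟩
  · rintro ⟨⟨_, g, hg, rfl⟩, hD, rfl⟩
    exact ⟨g, hg, hD, rfl⟩

theorem pullback_comp {f : X → Y} {g : Y → Z} (hf : ContMDiff 𝓘(ℂ, V) 𝓘(ℂ, V) ω f)
    (hg : ContMDiff 𝓘(ℂ, V) 𝓘(ℂ, V) ω g) (D : IdealStalks Z) :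
    pullback (g ∘ f) D = pullback f (pullback g D) := by
  funext x
  rw [pullback_apply (hg.comp hf), pullback_apply hf, pullback_apply hg, Ideal.map_map]
  congr 1
  ext1 ⟨_, h, hh, rfl⟩
  rfl

theorem pullback_id (D : IdealStalks X) : pullback id D = D := by
  funext x
  rw [pullback_apply contMDiff_id]
  have h : germComap id contMDiff_id x = RingHom.id (holGerm x) := by
    ext1 ⟨_, h, hh, rfl⟩
    rfl
  exact (congrArg (fun g => Ideal.map g (D x)) h).trans (Ideal.map_id (D x))

theorem pullback_prod {ι : Type} [Fintype ι] {f : X → Y} (hf : ContMDiff 𝓘(ℂ, V) 𝓘(ℂ, V) ω f)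
    (D : ι → IdealStalks Y) : pullback f (∏ k, D k) = ∏ k, pullback f (D k) := by
  funext x
  simp only [Finset.prod_apply, pullback_apply hf]
  exact map_prod (Ideal.mapHom (germComap f hf x)) _ _

theorem pullback_iterate {f : X → X} (hf : ContMDiff 𝓘(ℂ, V) 𝓘(ℂ, V) ω f) {D : IdealStalks X}
    (h : pullback f D = D) (n : ℕ) : pullback f^[n] D = D := by
  induction n with
  | zero => exact pullback_id D
  | succ n ih =>
    have hn : ContMDiff 𝓘(ℂ, V) 𝓘(ℂ, V) ω f^[n] := by
      clear ih
      induction n with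
      | zero => exact contMDiff_id
      | succ n ih => exact ih.comp hf
    rw [Function.iterate_succ, pullback_comp hf hn, ih, h]

/-- Invertibility matters: a germ vanishing on the preimage is itself the pull-back of its composite
with `γ⁻¹`. A ramified map could produce multiplicities. -/
theorem pullback_reducedCurve (γ : Diffeomorph 𝓘(ℂ, V) 𝓘(ℂ, V) X Y ω) (C : Set Y) :
    pullback γ (reducedCurve C) = reducedCurve (γ ⁻¹' C) := by
  funext x
  apply le_antisymm
  · refine Ideal.span_le.2 ?_
    rintro ⟨_, _⟩ ⟨g, hg, ⟨g', hgg', hC⟩, rfl⟩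
    refine ⟨g' ∘ γ, ?_, γ.continuous.continuousAt.eventually hC⟩
    exact Filter.Germ.coe_eq.2
      (γ.continuous.continuousAt.eventually (Filter.Germ.coe_eq.1 hgg'))
  · rintro ⟨_, f, hf, rfl⟩ ⟨f', hff', hC⟩
    have hff : f' =ᶠ[𝓝 x] f := Filter.Germ.coe_eq.1 hff'
    have hx : γ.symm (γ x) = x := γ.symm_apply_apply x
    have ht : Filter.Tendsto γ.symm (𝓝 (γ x)) (𝓝 x) := by
      simpa only [hx] using γ.symm.continuous.tendsto (γ x)
    refine Ideal.subset_span ⟨f ∘ γ.symm, ?_, ⟨f ∘ γ.symm, rfl, ?_⟩, ?_⟩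
    · exact ContMDiffAt.comp (γ x) (by rwa [hx]) (γ.symm.contMDiff _)
    · filter_upwards [ht.eventually hff, ht.eventually hC] with y h1 h2 hy
      rw [Function.comp_apply, ← h1]
      exact h2 (by simpa using hy)
    · congr 1
      funext y
      simp

end Pullback

/-! ### The automorphism `γ` of the equianharmonic product -/

theorem zeta_sq : ζ ^ 2 = ζ - 1 := by
  have h3 : √3 * √3 = 3 := Real.mul_self_sqrt (by norm_num)
  rw [zeta_eq]
  apply Complex.ext <;> simp [pow_two]
  · linear_combination -h3 / 4
  · ring

/-- `gammaLin` as a linear automorphism of `V`. -/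
def gammaEquiv : V ≃L[ℂ] V :=
  LinearEquiv.toContinuousLinearEquiv
    { toFun := gammaLin
      map_add' := fun v w => by ext <;> simp [gammaLin]; ring
      map_smul' := fun c v => by ext <;> simp [gammaLin]; ring
      -- `ζ - 1` is the inverse of `-ζ`, since `ζ² = ζ - 1`.
      invFun := fun w => ((ζ - 1) * (w.1 - w.2), w.2)
      left_inv := fun v => by
        ext
        · simp only [gammaLin]
          linear_combination (-v.1) * zeta_sq
        · rfl
      right_inv := fun w => by
        ext
        · simp only [gammaLin]
          linear_combination (w.2 - w.1) * zeta_sq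
        · rfl }

/-- The coefficient of `v.1` is `(-ζ)³ = 1`, and that of `v.2` is `1 - ζ + ζ² = 0`. -/
theorem gammaLin_iterate_three (v : V) : gammaLin (gammaLin (gammaLin v)) = v := by
  ext
  · simp only [gammaLin]
    linear_combination (-(ζ + 1) * v.1 + v.2) * zeta_sq
  · rfl

theorem zeta_mul_mem {z : ℂ} (hz : z ∈ Γζ) : ζ * z ∈ Γζ := by
  obtain ⟨m, n, rfl⟩ := mem_Γζ.1 hz
  refine mem_Γζ.2 ⟨m + n, -m, ?_⟩
  simp only [zsmul_eq_mul]
  push_cast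
  linear_combination -(m : ℂ) * zeta_sq

theorem gammaLin_mem {v : V} (hv : v ∈ lattice) : gammaLin v ∈ lattice :=
  ⟨by
    simp only [gammaLin, neg_mul]
    exact Γζ.add_mem (Γζ.neg_mem (zeta_mul_mem hv.1)) hv.2, hv.2⟩

theorem gammaEquiv_mem_iff (v : V) : gammaEquiv v ∈ lattice ↔ v ∈ lattice := by
  refine ⟨fun h => ?_, gammaLin_mem⟩
  -- The inverse is the square, so stability of the lattice in one direction gives both.
  rw [← gammaLin_iterate_three v]
  exact gammaLin_mem (gammaLin_mem h)

/-- The automorphism `γ` of `A'`. -/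
def gamma : Diffeomorph 𝓘(ℂ, V) 𝓘(ℂ, V) A' A' ω := torusDiffeo gammaEquiv gammaEquiv_mem_iff

theorem gamma_mk (v : V) : gamma (QuotientAddGroup.mk v) = QuotientAddGroup.mk (gammaLin v) := rfl

theorem half_notMem : (1 / 2 : ℂ) ∉ Γζ := by
  rw [mem_Γζ]
  rintro ⟨m, n, h⟩
  rw [zeta_eq] at h
  have h1 := congrArg Complex.re h
  have h2 := congrArg Complex.im h
  have h3 : √3 ≠ 0 := by positivity
  simp [h3] at h1 h2
  subst h2
  have h4 : ((2 * n : ℤ) : ℝ) = (1 : ℤ) := by push_cast; norm_num at h1; linarith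
  have h5 : 2 * n = 1 := by exact_mod_cast h4
  omega

theorem orderOf_gamma : orderOf (gamma.toEquiv : Equiv.Perm A') = 3 := by
  apply orderOf_eq_prime
  · ext ⟨v⟩
    exact congrArg QuotientAddGroup.mk (gammaLin_iterate_three v)
  · intro h
    -- This 2-torsion point is moved by `(1/2, 0)`, which is not in the lattice.
    have h1 : gamma (QuotientAddGroup.mk (0, 1 / 2)) = QuotientAddGroup.mk (0, 1 / 2) :=
      congrArg (fun e : Equiv.Perm A' => e (QuotientAddGroup.mk (0, 1 / 2))) h
    rw [gamma_mk] at h1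
    have h2 := (QuotientAddGroup.eq.1 h1.symm).1
    simp only [gammaLin, Prod.fst_add, Prod.fst_neg] at h2
    exact half_notMem (by simpa using h2)

/-- `γ` fixes the first of the four lines and permutes the other three cyclically. -/
def linePerm : Fin 4 → Fin 4 := ![0, 2, 3, 1]

theorem map_line_le (k : Fin 4) (v : V) (hv : v ∈ line k) : gammaLin v ∈ line (linePerm k) := by
  have hz := zeta_sq
  fin_cases k <;> obtain ⟨a, rfl⟩ := Submodule.mem_span_singleton.1 hv <;>
    refine Submodule.mem_span_singleton.2 ?_
  · exact ⟨-ζ * a, by ext <;> simp [gammaLin]⟩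
  · exact ⟨a, by ext <;> simp [gammaLin]⟩
  -- The image of `e₁ + e₂` is `(1 - ζ) e₁ + e₂ = (1 - ζ)(e₁ + ζ e₂)`, because `(1 - ζ) ζ = 1`.
  · refine ⟨(1 - ζ) * a, ?_⟩
    ext <;> simp [gammaLin]
    · ring
    · linear_combination (-a) * hz
  · refine ⟨ζ * a, ?_⟩
    ext <;> simp [gammaLin] <;> ring

theorem linePerm_iterate (k : Fin 4) : linePerm (linePerm (linePerm k)) = k := by
  fin_cases k <;> rfl

theorem preimage_E' (k : Fin 4) : gamma ⁻¹' (E' (linePerm k)) = E' k := by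
  ext x
  constructor
  · rintro ⟨w, hw, hx⟩
    -- The square of `gammaLin` is its inverse, and `linePerm` has order 3, so this preimage of `w`
    -- lies on line `k`.
    refine ⟨gammaLin (gammaLin w), ?_, ?_⟩
    · have := map_line_le _ _ (map_line_le _ _ hw)
      rwa [linePerm_iterate] at this
    · apply gamma.injective
      exact (congrArg QuotientAddGroup.mk (gammaLin_iterate_three w)).trans hx
  · rintro ⟨w, hw, rfl⟩
    exact ⟨gammaLin w, map_line_le k w hw, rfl⟩

theorem pullback_gamma_divA' : pullback gamma divA' = divA' := by
  have h0 := preimage_E' 0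
  have h1 := preimage_E' 1
  have h2 := preimage_E' 2
  have h3 := preimage_E' 3
  simp only [linePerm, Matrix.cons_val] at h0 h1 h2 h3
  rw [divA', pullback_prod gamma.contMDiff]
  simp only [pullback_reducedCurve, Fin.prod_univ_four, h0, h1, h2, h3]
  ac_rfl

/-! ### The characters -/

theorem ofValues_basis (ε : Fin 4 → ℤˣ) (i : Fin 4) :
    ofValues ε (latticeBasis i) = Additive.ofMul (ε i) := by
  simp [ofValues]

theorem signChar_ext {χ ψ : SignChar} (h : ∀ i, χ (latticeBasis i) = ψ (latticeBasis i)) :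
    χ = ψ := by
  have : χ.toIntLinearMap = ψ.toIntLinearMap := latticeBasis.ext h
  exact DFunLike.ext _ _ fun x => LinearMap.congr_fun this x

theorem signChar_add_self (χ : SignChar) : χ + χ = 0 := by
  ext x
  simp

theorem chi_two : chi 2 = chi 0 + chi 1 := by
  refine signChar_ext fun i => ?_
  fin_cases i <;> simp [chi, ofValues_basis]
  rfl

theorem chi_ne_zero (i : Fin 3) : chi i ≠ 0 := by
  intro h
  -- Neither vector suffices alone: `chi 1` is trivial on `λ₁` and `chi 2` on `λ₂`.
  have h0 := DFunLike.congr_fun h (latticeBasis 0)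
  have h1 := DFunLike.congr_fun h (latticeBasis 1)
  fin_cases i <;> simp [chi, ofValues_basis] at h0 h1

theorem signChar_zsmul (χ : SignChar) (n : ℤ) : n • χ = 0 ∨ n • χ = χ := by
  have h2 : (2 : ℤ) • χ = 0 := by rw [two_zsmul, signChar_add_self]
  obtain ⟨k, rfl | rfl⟩ := Int.even_or_odd' n
  · left; rw [mul_comm, mul_zsmul, h2, zsmul_zero]
  · right; rw [add_zsmul, mul_comm, mul_zsmul, h2, zsmul_zero, one_zsmul, zero_add]

theorem setOf_mem_Sig_ne_zero : {χ : SignChar | χ ∈ Sig ∧ χ ≠ 0} = Set.range chi := by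
  have m0 : chi 0 ∈ Sig := AddSubgroup.subset_closure (by simp)
  have m1 : chi 1 ∈ Sig := AddSubgroup.subset_closure (by simp)
  ext χ
  constructor
  · rintro ⟨hχ, h0⟩
    obtain ⟨m, n, rfl⟩ := AddSubgroup.mem_closure_pair.1 hχ
    rcases signChar_zsmul (chi 0) m with hm | hm <;>
      rcases signChar_zsmul (chi 1) n with hn | hn <;> rw [hm, hn] at h0 ⊢
    · simp at h0
    · exact ⟨1, by simp⟩
    · exact ⟨0, by simp⟩
    · exact ⟨2, chi_two⟩
  · rintro ⟨i, rfl⟩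
    refine ⟨?_, chi_ne_zero i⟩
    fin_cases i
    · exact m0
    · exact m1
    · exact chi_two ▸ Sig.add_mem m0 m1

theorem mem_kerLattice {χ : SignChar} {v : V} :
    v ∈ kerLattice χ ↔ ∃ h : v ∈ lattice, χ ⟨v, h⟩ = 0 := by
  constructor
  · rintro ⟨x, hx, rfl⟩
    exact ⟨x.2, hx⟩
  · rintro ⟨h, hv⟩
    exact ⟨⟨v, h⟩, hv, rfl⟩

/-- The restriction of `gammaLin` to the lattice. -/
def gammaLattice : lattice →+ lattice :=
  ((gammaEquiv : V →+ V).comp lattice.subtype).codRestrict lattice fun v => gammaLin_mem v.2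

theorem gammaLattice_basis (i : Fin 4) : gammaLattice (latticeBasis i) =
    ![latticeBasis 2 - latticeBasis 0, latticeBasis 0 + latticeBasis 1, -latticeBasis 0,
      latticeBasis 2 + latticeBasis 3] i := by
  apply Subtype.ext
  change gammaLin (latticeBasis i) = _
  have hz := zeta_sq
  fin_cases i <;> simp [latticeBasis_apply, latticeVec, gammaLin]
  linear_combination -hz

/-- The index `j + 1` is taken modulo 3. Equality is checked on the basis, through the images in
`gammaLattice_basis`. -/
theorem chi_gammaLattice (j : Fin 3) (x : lattice) : chi (j + 1) (gammaLattice x) = chi j x := by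
  have : (chi (j + 1)).comp gammaLattice = chi j := by
    refine signChar_ext fun i => ?_
    rw [AddMonoidHom.comp_apply, gammaLattice_basis]
    fin_cases j <;> fin_cases i <;>
      simp [chi, ofValues_basis] <;> rfl
  exact DFunLike.congr_fun this x

theorem gammaEquiv_mem_kerLattice (j : Fin 3) (v : V) :
    gammaEquiv v ∈ kerLattice (chi (j + 1)) ↔ v ∈ kerLattice (chi j) := by
  simp only [mem_kerLattice]
  constructor
  · rintro ⟨h, hv⟩
    have h' := (gammaEquiv_mem_iff v).1 h
    exact ⟨h', (chi_gammaLattice j ⟨v, h'⟩).symm.trans hv⟩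
  · rintro ⟨h, hv⟩
    exact ⟨gammaLin_mem h, (chi_gammaLattice j ⟨v, h⟩).trans hv⟩

open Fin.NatCast in
theorem gammaEquiv_pow_mem_kerLattice (n : ℕ) (j : Fin 3) (v : V) :
    (gammaEquiv ^ n) v ∈ kerLattice (chi (j + (n : Fin 3))) ↔ v ∈ kerLattice (chi j) := by
  induction n with
  | zero =>
    rw [Nat.cast_zero, add_zero]
    rfl
  | succ n ih =>
    rw [← ih, pow_succ', Nat.cast_succ, ← add_assoc]
    exact gammaEquiv_mem_kerLattice _ _

theorem gammaEquiv_pow_sub_mem_kerLattice (i j : Fin 3) (v : V) :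
    (gammaEquiv ^ ((i - j : Fin 3) : ℕ)) v ∈ kerLattice (chi i) ↔ v ∈ kerLattice (chi j) := by
  rw [← gammaEquiv_pow_mem_kerLattice ((i - j : Fin 3) : ℕ) j v, Fin.cast_val_eq_self,
    add_sub_cancel]

theorem gamma_iterate_mk (n : ℕ) (v : V) :
    gamma^[n] (QuotientAddGroup.mk v) = QuotientAddGroup.mk ((gammaEquiv ^ n) v) := by
  induction n with
  | zero => rfl
  | succ n ih =>
    rw [Function.iterate_succ_apply', ih, gamma_mk, pow_succ']
    rfl

theorem contMDiff_isogeny (χ : SignChar) : ContMDiff 𝓘(ℂ, V) 𝓘(ℂ, V) ω (isogeny χ) :=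
  contMDiff_of_comp_mk (contMDiff_mk lattice)

/-! ### Polarizations -/

theorem span_kerLattice (χ : SignChar) :
    Submodule.span ℝ (kerLattice χ : Set V) = ⊤ := by
  have hspan : Submodule.span ℝ (Set.range latticeVec) = ⊤ :=
    linearIndependent_latticeVec.span_eq_top_of_card_eq_finrank' (by simp)
  rw [eq_top_iff, ← hspan, Submodule.span_le]
  rintro _ ⟨i, rfl⟩
  -- A sign character kills twice the lattice, which already spans `V` over `ℝ`.
  have h2 : latticeVec i + latticeVec i ∈ kerLattice χ := by
    refine mem_kerLattice.2 ⟨lattice.add_mem (latticeVec_mem i) (latticeVec_mem i), ?_⟩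
    rw [← AddMemClass.mk_add_mk lattice (latticeVec i) (latticeVec i) (latticeVec_mem i)
      (latticeVec_mem i), map_add]
    exact DFunLike.congr_fun (signChar_add_self χ) ⟨latticeVec i, latticeVec_mem i⟩
  have h3 := Submodule.smul_mem _ (1 / 2 : ℝ) (Submodule.subset_span (R := ℝ) h2)
  rw [← two_smul ℝ, smul_smul] at h3
  simpa using h3

/-- The imaginary part is `√3 / 2` times the determinant of the coordinates in the basis `ζ, 1`; the
factor `2 / √3` makes it an integer. -/
theorem exists_im_eq {z w : ℂ} (hz : z ∈ Γζ) (hw : w ∈ Γζ) :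
    ∃ n : ℤ, (2 / √3 : ℝ) * (z * starRingEnd ℂ w).im = n := by
  obtain ⟨m, n, rfl⟩ := mem_Γζ.1 hz
  obtain ⟨p, q, rfl⟩ := mem_Γζ.1 hw
  refine ⟨m * q - n * p, ?_⟩
  have h3 : √3 ≠ 0 := by positivity
  rw [zeta_eq]
  simp
  field_simp
  ring

/-- The hermitian form `(2 / √3) (v₁ w̄₁ + v₂ w̄₂)`. -/
def hermForm : V →ₗ[ℂ] V →ₗ⋆[ℂ] ℂ :=
  LinearMap.mk₂'ₛₗ (RingHom.id ℂ) (starRingEnd ℂ)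
    (fun v w => ((2 / √3 : ℝ) : ℂ) * (v.1 * starRingEnd ℂ w.1 + v.2 * starRingEnd ℂ w.2))
    (fun _ _ _ => by simp only [Prod.fst_add, Prod.snd_add]; ring)
    (fun _ _ _ => by
      simp only [Prod.smul_fst, Prod.smul_snd, smul_eq_mul, RingHom.id_apply]; ring)
    (fun _ _ _ => by simp only [Prod.fst_add, Prod.snd_add, map_add]; ring)
    (fun _ _ _ => by simp only [Prod.smul_fst, Prod.smul_snd, smul_eq_mul, map_mul]; ring)

theorem hermForm_apply (v w : V) : hermForm v w =
    ((2 / √3 : ℝ) : ℂ) * (v.1 * starRingEnd ℂ w.1 + v.2 * starRingEnd ℂ w.2) := rfl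

theorem isAbelianSurface_kerLattice (χ : SignChar) : IsAbelianSurface (kerLattice χ) where
  discrete := inferInstance
  span_eq_top := span_kerLattice χ
  polarization := by
    refine ⟨hermForm, fun v w => ?_, fun v hv => ?_, fun v hv w hw => ?_⟩
    · simp only [hermForm_apply, map_mul, map_add, Complex.conj_ofReal, Complex.conj_conj]
      ring
    · have h : (0 : ℝ) < 2 / √3 := by positivity
      rw [hermForm_apply, Complex.mul_conj, Complex.mul_conj, Complex.re_ofReal_mul,
        ← Complex.ofReal_add, Complex.ofReal_re]
      refine mul_pos h ?_
      have n1 := Complex.normSq_nonneg v.1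
      have n2 := Complex.normSq_nonneg v.2
      rcases n1.lt_or_eq with h1 | h1
      · linarith
      rcases n2.lt_or_eq with h2 | h2
      · linarith
      · exact absurd (Prod.ext (Complex.normSq_eq_zero.1 h1.symm)
          (Complex.normSq_eq_zero.1 h2.symm)) hv
    · have hv' := kerLattice_le χ hv
      have hw' := kerLattice_le χ hw
      obtain ⟨m, hm⟩ := exists_im_eq hv'.1 hw'.1
      obtain ⟨n, hn⟩ := exists_im_eq hv'.2 hw'.2
      refine ⟨m + n, ?_⟩
      rw [hermForm_apply, Complex.im_ofReal_mul, Complex.add_im, mul_add, hm, hn]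
      push_cast
      rfl

/-! ### The isomorphisms between the covers -/

theorem exists_lift_gamma (i j : Fin 3) :
    ∃ φ : Diffeomorph 𝓘(ℂ, V) 𝓘(ℂ, V) (cover (chi j)) (cover (chi i)) ω,
      (∀ x y, φ (x + y) = φ x + φ y) ∧
      (∀ x, isogeny (chi i) (φ x) = gamma^[((i - j : Fin 3) : ℕ)] (isogeny (chi j) x)) ∧
      pullback φ (divCover (chi i)) = divCover (chi j) := by
  set n : ℕ := ((i - j : Fin 3) : ℕ) with hn
  set φ : Diffeomorph 𝓘(ℂ, V) 𝓘(ℂ, V) (cover (chi j)) (cover (chi i)) ω :=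
    torusDiffeo (gammaEquiv ^ n) (gammaEquiv_pow_sub_mem_kerLattice i j) with hφ
  have hcomm : ∀ x, isogeny (chi i) (φ x) = gamma^[n] (isogeny (chi j) x) := by
    rintro ⟨v⟩
    exact (gamma_iterate_mk n v).symm
  have hiter : ContMDiff 𝓘(ℂ, V) 𝓘(ℂ, V) ω gamma^[n] := by
    refine contMDiff_of_comp_mk ?_
    simp only [gamma_iterate_mk]
    exact (contMDiff_mk lattice).comp (gammaEquiv ^ n).contDiff.contMDiff
  refine ⟨φ, torusDiffeo_add _ _, hcomm, ?_⟩
  -- With `f_i ∘ φ = γⁿ ∘ f_j`, the left side becomes the pull-back by `f_j` of `(γⁿ)^* D`, and `D`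
  -- is `γ`-invariant.
  rw [divCover, ← pullback_comp φ.contMDiff (contMDiff_isogeny _),
    show isogeny (chi i) ∘ φ = gamma^[n] ∘ isogeny (chi j) from funext hcomm,
    pullback_comp (contMDiff_isogeny _) hiter,
    pullback_iterate gamma.contMDiff pullback_gamma_divA', divCover]

end Equianharmonic

end

theorem mainTheorem12 :
    {χ : Equianharmonic.SignChar | χ ∈ Equianharmonic.Sig ∧ χ ≠ 0} =
        Set.range Equianharmonic.chi ∧
    (∀ i, Equianharmonic.IsAbelianSurface
      (Equianharmonic.kerLattice (Equianharmonic.chi i))) ∧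
    ∃ γ : Diffeomorph 𝓘(ℂ, Equianharmonic.V) 𝓘(ℂ, Equianharmonic.V)
        Equianharmonic.A' Equianharmonic.A' ω,
      (∀ x y, γ (x + y) = γ x + γ y) ∧
      (∀ v : Equianharmonic.V, γ (QuotientAddGroup.mk v) =
        QuotientAddGroup.mk (Equianharmonic.gammaLin v)) ∧
      orderOf (γ.toEquiv : Equiv.Perm Equianharmonic.A') = 3 ∧
      Equianharmonic.pullback γ Equianharmonic.divA' = Equianharmonic.divA' ∧
      ∀ i j : Fin 3,
        ∃ φ : Diffeomorph 𝓘(ℂ, Equianharmonic.V) 𝓘(ℂ, Equianharmonic.V)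
            (Equianharmonic.cover (Equianharmonic.chi j))
            (Equianharmonic.cover (Equianharmonic.chi i)) ω,
          (∀ x y, φ (x + y) = φ x + φ y) ∧
          (∀ x, Equianharmonic.isogeny (Equianharmonic.chi i) (φ x) =
            γ^[((i - j : Fin 3) : ℕ)] (Equianharmonic.isogeny (Equianharmonic.chi j) x)) ∧
          Equianharmonic.pullback φ (Equianharmonic.divCover (Equianharmonic.chi i)) =
            Equianharmonic.divCover (Equianharmonic.chi j) := by

  exact ⟨Equianharmonic.setOf_mem_Sig_ne_zero,
    fun i => Equianharmonic.isAbelianSurface_kerLattice _,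
    Equianharmonic.gamma, Equianharmonic.torusDiffeo_add _ _, Equianharmonic.gamma_mk,
    Equianharmonic.orderOf_gamma, Equianharmonic.pullback_gamma_divA',
    Equianharmonic.exists_lift_gamma⟩
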